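/- There is a universal constant $c > 0$ such that the following holds for all positive integers $n, d, s$ with $s \le d$, every $\sigma > 0$ and every nonzero matrix $X \in \mathbb{R}^{n \times d}$. For $\theta \in \mathbb{R}^d$ let $\|\theta\|_0$ be the number of nonzero entries of $\theta$, and let $P_\theta = \mathsf{N}(X\theta, \sigma^2 I_{n\times n})$ be the law of $Y = X\theta + \varepsilon$, where $\varepsilon \in \mathbb{R}^n$ has i.i.d. $\mathsf{N}(0,\sigma^2)$ entries. Then $$\inf_{\hat\theta}\ \sup_{\theta \in \mathbb{R}^d,\ \|\theta\|_0 \le s} \mathbb{E}_{Y \sim P_\theta}\left[\|\hat\theta(Y) - \theta\|_2^2\right] \;\ge\; c\,\frac{\sigma^2\, s\, d\, \log(d/s)}{\|X\|_F^2},$$ where the infimum is over all measurable functions $\hat\theta : \mathbb{R}^n \to \mathbb{R}^d$ (which may depend on the fixed matrix $X$), the left-hand side takes values in $[0,\infty]$, and $\|X\|_F$ is the Frobenius norm of $X$. -/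

import Mathlib

open MeasureTheory ProbabilityTheory
open scoped NNReal ENNReal Matrix Matrix.Norms.Frobenius

/-- The minimax risk `inf_{θhat} sup_i E_{P i}[ℓ (θhat, θ i)]` of a family of distributions
`P i` on a sample space `𝓧`, with parameters `θ i`, for the loss `ℓ`. The infimum is over all
measurable functions of the observation, with values in the whole parameter space `Θ`.
Expectations of the nonnegative loss take values in `[0, ∞]`. -/
noncomputable def minimaxRiskOf {ι 𝓧 Θ : Type*} [MeasurableSpace 𝓧] [MeasurableSpace Θ]
    (P : ι → Measure 𝓧) (θ : ι → Θ) (ℓ : Θ → Θ → ℝ≥0∞) : ℝ≥0∞ :=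
  ⨅ (θhat : 𝓧 → Θ) (_ : Measurable θhat), ⨆ i, ∫⁻ x, ℓ (θhat x) (θ i) ∂(P i)

/-- The squared Euclidean loss `‖u - v‖₂²` on `ℝ^d`. -/
noncomputable def sqL2Loss {d : ℕ} (u v : EuclideanSpace ℝ (Fin d)) : ℝ≥0∞ :=
  ENNReal.ofReal (‖u - v‖ ^ 2)

/-- The number `‖θ‖₀` of nonzero entries of a vector. -/
noncomputable def l0 {d : ℕ} (θ : EuclideanSpace ℝ (Fin d)) : ℕ :=
  {j : Fin d | θ j ≠ 0}.ncard

/-- The `s`-sparse vectors of `ℝ^d`. -/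
abbrev SparseVec (d s : ℕ) : Type := {θ : EuclideanSpace ℝ (Fin d) // l0 θ ≤ s}

/-- The law `N(X θ, σ² I)` of `Y = X θ + ε` on `ℝ^n`, where the entries of `ε` are i.i.d.
`N(0, σ²)`: the product of the one-dimensional laws `N((X θ) i, σ²)`. -/
noncomputable def regressionLaw {n d : ℕ} (X : Matrix (Fin n) (Fin d) ℝ) (σ : ℝ≥0)
    (θ : EuclideanSpace ℝ (Fin d)) : Measure (Fin n → ℝ) :=
  Measure.pi fun i => gaussianReal ((X *ᵥ θ.ofLp) i) (σ ^ 2)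

/-- The minimax risk, in squared Euclidean norm, of estimating `θ` over the family of laws
`N(X θ, σ² I)`, `‖θ‖₀ ≤ s`, for a fixed design matrix `X`. -/
noncomputable def sparseRegressionMinimaxRisk {n d : ℕ} (X : Matrix (Fin n) (Fin d) ℝ)
    (σ : ℝ≥0) (s : ℕ) : ℝ≥0∞ :=
  minimaxRiskOf (fun θ : SparseVec d s => regressionLaw X σ θ.1) (fun θ => θ.1) sqL2Loss

/-!
Use the product prior that places one spike of height `a` at a uniform position of each of several
disjoint blocks of coordinates. Adding a spike at position `j` shifts the Gaussian law by
`v = a • X_j`; the square of the likelihood ratio of a shift by `v` is `exp (‖v‖² / σ²)` times the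
likelihood ratio of the shift by `2 v`, so Cauchy–Schwarz bounds the squared probability of an
event by `exp (‖v‖² / σ²)` times its probability without the spike. Since disjoint events have total
probability at most one, no test locates the spike in its block with average success probability
above `7 / 8` as long as `exp (‖v‖² / σ²)` is at most the square root of the block length. By
Markov's inequality every block then costs a constant multiple of `a²`, and the costs add up.

The Frobenius norm enters because more than half of the columns have squared norm at most
`2 ‖X‖² / d`; the blocks consist of these columns, which allows `a² ≍ σ² d log (d / s) / ‖X‖²` with
about `s / 4` blocks.
-/

open scoped BigOperators

section ProductPrior

variable {κ α : Type*} [Fintype κ] [DecidableEq κ] [Fintype α]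

lemma expect_expect_update [Nonempty α] {M : Type*} [AddCommMonoid M] [Module ℚ≥0 M]
    (k : κ) (F : (κ → α) → M) :
    𝔼 f, 𝔼 j, F (Function.update f k j) = 𝔼 f, F f := by
  -- Exchanging the `k`-th value of `f` with `j` is an involution of the pairs `(f, j)`.
  let swap : (κ → α) × α → (κ → α) × α := fun q => (Function.update q.1 k q.2, q.1 k)
  have hswap : Function.Involutive swap := fun q => by simp [swap]
  calc 𝔼 f, 𝔼 j, F (Function.update f k j) = 𝔼 q, F (swap q).1 :=
        (Finset.expect_product' Finset.univ Finset.univ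
          fun f j => F (Function.update f k j)).symm
    _ = 𝔼 q : (κ → α) × α, F q.1 :=
        Fintype.expect_equiv hswap.toPerm _ _ fun _ => rfl
    _ = 𝔼 f, 𝔼 _j : α, F f := Finset.expect_product' Finset.univ Finset.univ fun f _ => F f
    _ = 𝔼 f, F f := by simp_rw [Fintype.expect_const]

lemma exists_sum_le_of_expect_update_le [Nonempty α] {F : κ → (κ → α) → ℝ} {p : ℝ}
    (h : ∀ k f, 𝔼 j, F k (Function.update f k j) ≤ p) :
    ∃ f, ∑ k, F k f ≤ Fintype.card κ * p := by
  have havg : 𝔼 f, ∑ k, F k f ≤ Fintype.card κ * p := by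
    rw [Finset.expect_sum_comm, ← nsmul_eq_mul]
    refine Finset.sum_le_card_nsmul _ _ _ fun k _ => ?_
    rw [← expect_expect_update k]
    exact Finset.expect_le Finset.univ_nonempty fun f _ => h k f
  obtain ⟨f, -, hf⟩ := Finset.exists_le_of_expect_le Finset.univ_nonempty havg
  exact ⟨f, hf⟩

end ProductPrior

lemma expect_measureReal_sq_le_of_disjoint {𝓧 α : Type*} [MeasurableSpace 𝓧] [Fintype α]
    {Q : Measure 𝓧} [IsProbabilityMeasure Q] {P : α → Measure 𝓧} {A : α → Set 𝓧}
    (hA : ∀ j, MeasurableSet (A j)) (hdisj : Pairwise (Function.onFun Disjoint A)) {M : ℝ}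
    (hM : 0 ≤ M) (hPQ : ∀ j, (P j).real (A j) ^ 2 ≤ M * Q.real (A j)) :
    (𝔼 j, (P j).real (A j)) ^ 2 ≤ M / Fintype.card α := by
  have hQ : ∑ j, Q.real (A j) ≤ 1 := by
    rw [← measureReal_iUnion_fintype hdisj hA]
    exact measureReal_le_one
  rcases isEmpty_or_nonempty α with hα | hα
  · simp
  calc (𝔼 j, (P j).real (A j)) ^ 2 ≤ 𝔼 j, (P j).real (A j) ^ 2 := by
        simpa using Finset.expect_mul_sq_le_sq_mul_sq Finset.univ (fun j => (P j).real (A j)) 1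
    _ ≤ 𝔼 j, M * Q.real (A j) := Finset.expect_le_expect fun j _ => hPQ j
    _ = M * (∑ j, Q.real (A j)) / Fintype.card α := by
        rw [Fintype.expect_eq_sum_div_card, Finset.mul_sum]
    _ ≤ M / Fintype.card α := by gcongr; exact mul_le_of_le_one_right hM hQ

section MinimaxRisk

variable {ι 𝓧 Θ : Type*} [MeasurableSpace 𝓧] [MeasurableSpace Θ]

lemma minimaxRiskOf_comp_le {ι' : Type*} (g : ι' → ι) (P : ι → Measure 𝓧) (θ : ι → Θ)
    (ℓ : Θ → Θ → ℝ≥0∞) : minimaxRiskOf (P ∘ g) (θ ∘ g) ℓ ≤ minimaxRiskOf P θ ℓ :=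
  iInf₂_mono fun θhat _ => iSup_comp_le (fun i => ∫⁻ x, ℓ (θhat x) (θ i) ∂(P i)) g

lemma mul_le_minimaxRiskOf_of_blocks {κ α : Type*} [Fintype κ] [DecidableEq κ] [Fintype α]
    [Nonempty α] {P : (κ → α) → Measure 𝓧} [∀ f, IsProbabilityMeasure (P f)]
    {θ : (κ → α) → Θ} {ℓ : Θ → Θ → ℝ≥0∞} {ℓb : κ → α → Θ → ℝ≥0∞} {δ : ℝ≥0∞} {p : ℝ}
    (hmeas : ∀ k j, Measurable (ℓb k j))
    (hsum : ∀ f u, ∑ k, ℓb k (f k) u ≤ ℓ u (θ f))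
    (hsep : ∀ k u, Pairwise fun i j => δ + δ ≤ ℓb k i u + ℓb k j u)
    (htest : ∀ k f (A : α → Set 𝓧), (∀ j, MeasurableSet (A j)) →
      Pairwise (Function.onFun Disjoint A) →
        𝔼 j, (P (Function.update f k j)).real (A j) ≤ p) :
    δ * ENNReal.ofReal (Fintype.card κ * (1 - p)) ≤ minimaxRiskOf P θ ℓ := by
  refine le_iInf₂ fun θhat hθhat => ?_
  -- Declaring position `j` when the block loss at `j` is below `δ` is a test, by `hsep`.
  let A (k : κ) (j : α) : Set 𝓧 := {y | ℓb k j (θhat y) < δ}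
  have hA (k : κ) (j : α) : MeasurableSet (A k j) :=
    measurableSet_lt ((hmeas k j).comp hθhat) measurable_const
  have hdisj (k : κ) : Pairwise (Function.onFun Disjoint (A k)) := fun i j hij =>
    Set.disjoint_left.2 fun y hi hj => (hsep k (θhat y) hij).not_gt (ENNReal.add_lt_add hi hj)
  obtain ⟨f, hf⟩ := exists_sum_le_of_expect_update_le
    (F := fun k f => (P f).real (A k (f k))) (p := p) fun k f => by
      simpa using htest k f (A k) (hA k) (hdisj k)
  have herr : ENNReal.ofReal (Fintype.card κ * (1 - p)) ≤ ∑ k, P f (A k (f k))ᶜ := by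
    simp_rw [← ofReal_measureReal (measure_ne_top (P f) _), probReal_compl_eq_one_sub (hA _ _)]
    rw [← ENNReal.ofReal_sum_of_nonneg fun k _ => sub_nonneg.2 measureReal_le_one]
    refine ENNReal.ofReal_le_ofReal ?_
    simp only [Finset.sum_sub_distrib, Finset.sum_const, Finset.card_univ, nsmul_eq_mul]
    linarith
  refine le_iSup_of_le f ?_
  calc δ * ENNReal.ofReal (Fintype.card κ * (1 - p))
      ≤ ∑ k, δ * P f {y | δ ≤ ℓb k (f k) (θhat y)} := by
        rw [← Finset.mul_sum]
        gcongr
        simpa only [A, Set.compl_ofPred, not_lt] using herr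
    _ ≤ ∑ k, ∫⁻ y, ℓb k (f k) (θhat y) ∂(P f) :=
        Finset.sum_le_sum fun k _ => mul_meas_ge_le_lintegral ((hmeas k (f k)).comp hθhat) δ
    _ = ∫⁻ y, ∑ k, ℓb k (f k) (θhat y) ∂(P f) :=
        (lintegral_finsetSum _ fun k _ => (hmeas k (f k)).comp hθhat).symm
    _ ≤ ∫⁻ y, ℓ (θhat y) (θ f) ∂(P f) := lintegral_mono fun y => hsum f (θhat y)

end MinimaxRisk

section Density

lemma withDensity_apply_sq_le {α : Type*} [MeasurableSpace α] (Q : Measure α) [SFinite Q]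
    {L : α → ℝ≥0∞} (hL : AEMeasurable L Q) (A : Set α) :
    Q.withDensity L A ^ 2 ≤ (∫⁻ x, L x ^ 2 ∂Q) * Q A := by
  have hsqrt : ∀ a : ℝ≥0∞, (a ^ (1 / 2 : ℝ)) ^ 2 = a := fun a => by
    rw [← ENNReal.rpow_mul_natCast]; norm_num
  have hCS := ENNReal.lintegral_mul_le_Lp_mul_Lq (Q.restrict A) Real.HolderConjugate.two_two
    hL.restrict (aemeasurable_const (b := 1))
  simp only [Pi.mul_apply, mul_one, one_pow, ENNReal.rpow_two, lintegral_const,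
    Measure.restrict_apply_univ, one_mul] at hCS
  calc Q.withDensity L A ^ 2 = (∫⁻ x in A, L x ∂Q) ^ 2 := by rw [withDensity_apply' L A]
    _ ≤ ((∫⁻ x in A, L x ^ 2 ∂Q) ^ (1 / 2 : ℝ) * Q A ^ (1 / 2 : ℝ)) ^ 2 := by gcongr
    _ = (∫⁻ x in A, L x ^ 2 ∂Q) * Q A := by rw [mul_pow, hsqrt, hsqrt]
    _ ≤ (∫⁻ x, L x ^ 2 ∂Q) * Q A := by gcongr; exact Measure.restrict_le_self

lemma pi_withDensity {ι : Type*} [Fintype ι] {X : ι → Type*} [∀ i, MeasurableSpace (X i)]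
    (Q : ∀ i, Measure (X i)) [∀ i, IsProbabilityMeasure (Q i)] {L : ∀ i, X i → ℝ≥0∞}
    (hL : ∀ i, Measurable (L i)) [∀ i, SigmaFinite ((Q i).withDensity (L i))] :
    Measure.pi (fun i => (Q i).withDensity (L i)) =
      (Measure.pi Q).withDensity fun y => ∏ i, L i (y i) := by
  refine Measure.pi_eq (μ := fun i => (Q i).withDensity (L i)) fun s hs => ?_
  have hind (i : ι) : Measurable ((s i).indicator (L i)) := (hL i).indicator (hs i)
  have hprod (y : ∀ i, X i) : (Set.univ.pi s).indicator (fun y => ∏ i, L i (y i)) y =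
      ∏ i, (s i).indicator (L i) (y i) := by
    by_cases hy : y ∈ Set.univ.pi s
    · rw [Set.indicator_of_mem hy]
      exact Finset.prod_congr rfl fun i _ => (Set.indicator_of_mem (hy i trivial) _).symm
    · obtain ⟨i, hi⟩ : ∃ i, y i ∉ s i := by simpa using hy
      rw [Set.indicator_of_notMem hy]
      exact (Finset.prod_eq_zero (Finset.mem_univ i) (Set.indicator_of_notMem hi _)).symm
  calc (Measure.pi Q).withDensity (fun y => ∏ i, L i (y i)) (Set.univ.pi s)
      = ∫⁻ y, ∏ i, (s i).indicator (L i) (y i) ∂(Measure.pi Q) := by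
        rw [withDensity_apply' _ _, ← lintegral_indicator (MeasurableSet.univ_pi hs)]
        simp_rw [hprod]
    _ = ∏ i, ∫⁻ y, (s i).indicator (L i) (y i) ∂(Measure.pi Q) :=
        lintegral_prod_eq_prod_lintegral_of_indepFun _ _
          (iIndepFun_pi fun i => (hind i).aemeasurable)
          fun i => (hind i).comp (measurable_pi_apply i)
    _ = ∏ i, (Q i).withDensity (L i) (s i) := by
        refine Finset.prod_congr rfl fun i _ => ?_
        rw [(measurePreserving_eval Q i).lintegral_comp (hind i), lintegral_indicator (hs i),
          withDensity_apply _ (hs i)]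

end Density

section Gaussian

/-- The likelihood ratio `dN(μ + v, V) / dN(μ, V)` at `x`, by which shifts of a Gaussian are
compared; it is the constant `1` when `V = 0`. -/
noncomputable def gaussianShiftDensity (V : ℝ≥0) (μ v x : ℝ) : ℝ≥0∞ :=
  ENNReal.ofReal (Real.exp ((v * (x - μ) - v ^ 2 / 2) / V))

lemma measurable_gaussianShiftDensity (V : ℝ≥0) (μ v : ℝ) :
    Measurable (gaussianShiftDensity V μ v) := by
  unfold gaussianShiftDensity
  fun_prop

lemma gaussianShiftDensity_sq (V : ℝ≥0) (μ v x : ℝ) :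
    gaussianShiftDensity V μ v x ^ 2 =
      ENNReal.ofReal (Real.exp (v ^ 2 / V)) * gaussianShiftDensity V μ (2 * v) x := by
  simp only [gaussianShiftDensity]
  rw [← ENNReal.ofReal_pow (Real.exp_nonneg _), ← ENNReal.ofReal_mul (Real.exp_nonneg _),
    ← Real.exp_nat_mul, ← Real.exp_add]
  congr 2
  push_cast
  ring

variable {V : ℝ≥0}

lemma gaussianReal_add_eq_withDensity (hV : V ≠ 0) (μ v : ℝ) :
    gaussianReal (μ + v) V = (gaussianReal μ V).withDensity (gaussianShiftDensity V μ v) := by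
  have hV' : (V : ℝ) ≠ 0 := NNReal.coe_ne_zero.2 hV
  rw [gaussianReal_of_var_ne_zero _ hV, gaussianReal_of_var_ne_zero _ hV,
    ← withDensity_mul _ (measurable_gaussianPDF μ V) (measurable_gaussianShiftDensity V μ v)]
  congr 1 with x
  rw [Pi.mul_apply, gaussianPDF, gaussianPDF, gaussianShiftDensity,
    ← ENNReal.ofReal_mul (gaussianPDFReal_nonneg _ _ _), gaussianPDFReal, gaussianPDFReal,
    mul_assoc (√(2 * Real.pi * V))⁻¹, ← Real.exp_add]
  congr 3
  field_simp
  ring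

variable {ι : Type*} [Fintype ι]

lemma pi_gaussianReal_add_eq_withDensity (hV : V ≠ 0) (μ v : ι → ℝ) :
    Measure.pi (fun i => gaussianReal (μ i + v i) V) =
      (Measure.pi fun i => gaussianReal (μ i) V).withDensity
        fun y => ∏ i, gaussianShiftDensity V (μ i) (v i) (y i) := by
  have (i : ι) : SigmaFinite
      ((gaussianReal (μ i) V).withDensity (gaussianShiftDensity V (μ i) (v i))) := by
    rw [← gaussianReal_add_eq_withDensity hV]
    infer_instance
  simp_rw [gaussianReal_add_eq_withDensity hV]
  exact pi_withDensity _ fun i => measurable_gaussianShiftDensity V (μ i) (v i)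

lemma lintegral_prod_gaussianShiftDensity (hV : V ≠ 0) (μ v : ι → ℝ) :
    ∫⁻ y, ∏ i, gaussianShiftDensity V (μ i) (v i) (y i)
      ∂(Measure.pi fun i => gaussianReal (μ i) V) = 1 := by
  rw [← setLIntegral_univ, ← withDensity_apply _ MeasurableSet.univ,
    ← pi_gaussianReal_add_eq_withDensity hV, measure_univ]

lemma lintegral_prod_gaussianShiftDensity_sq (hV : V ≠ 0) (μ v : ι → ℝ) :
    ∫⁻ y, (∏ i, gaussianShiftDensity V (μ i) (v i) (y i)) ^ 2
      ∂(Measure.pi fun i => gaussianReal (μ i) V) =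
        ENNReal.ofReal (Real.exp ((∑ i, v i ^ 2) / V)) := by
  simp_rw [← Finset.prod_pow, gaussianShiftDensity_sq, Finset.prod_mul_distrib]
  rw [lintegral_const_mul' _ _ (ENNReal.prod_ne_top fun _ _ => ENNReal.ofReal_ne_top),
    lintegral_prod_gaussianShiftDensity hV μ fun i => 2 * v i, mul_one,
    ← ENNReal.ofReal_prod_of_nonneg fun _ _ => Real.exp_nonneg _, ← Real.exp_sum, Finset.sum_div]

lemma pi_gaussianReal_add_real_sq_le (hV : V ≠ 0) (μ v : ι → ℝ) (A : Set (ι → ℝ)) :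
    (Measure.pi fun i => gaussianReal (μ i + v i) V).real A ^ 2 ≤
      Real.exp ((∑ i, v i ^ 2) / V) * (Measure.pi fun i => gaussianReal (μ i) V).real A := by
  have hL : Measurable fun y : ι → ℝ => ∏ i, gaussianShiftDensity V (μ i) (v i) (y i) :=
    Finset.measurable_fun_prod _ fun i _ =>
      (measurable_gaussianShiftDensity V (μ i) (v i)).comp (measurable_pi_apply i)
  have h := withDensity_apply_sq_le (Measure.pi fun i => gaussianReal (μ i) V) hL.aemeasurable A
  rw [lintegral_prod_gaussianShiftDensity_sq hV, ← pi_gaussianReal_add_eq_withDensity hV] at h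
  have hreal := ENNReal.toReal_mono
    (ENNReal.mul_ne_top ENNReal.ofReal_ne_top (measure_ne_top _ _)) h
  rwa [ENNReal.toReal_pow, ENNReal.toReal_mul, ENNReal.toReal_ofReal (Real.exp_nonneg _)] at hreal

end Gaussian

section RegressionLaw

variable {n d : ℕ} (X : Matrix (Fin n) (Fin d) ℝ) {σ : ℝ≥0}

instance isProbabilityMeasure_regressionLaw (σ : ℝ≥0) (θ : EuclideanSpace ℝ (Fin d)) :
    IsProbabilityMeasure (regressionLaw X σ θ) := by
  unfold regressionLaw
  infer_instance

lemma regressionLaw_add_single_real_sq_le (hσ : σ ≠ 0) (θ : EuclideanSpace ℝ (Fin d)) (j : Fin d)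
    (a : ℝ) (A : Set (Fin n → ℝ)) :
    (regressionLaw X σ (θ + EuclideanSpace.single j a)).real A ^ 2 ≤
      Real.exp (a ^ 2 * (∑ i, X i j ^ 2) / σ ^ 2) * (regressionLaw X σ θ).real A := by
  have h := pi_gaussianReal_add_real_sq_le (pow_ne_zero 2 hσ) (X *ᵥ θ.ofLp)
    (X *ᵥ Pi.single j a) A
  simpa [regressionLaw, Matrix.mulVec_add, Matrix.mulVec_single, mul_pow, Finset.mul_sum,
    mul_comm] using h

end RegressionLaw

/-- The vector with entry `a` at the position `e (k, f k)` for each block `k`, and zeros elsewhere: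
the support of the product prior. The embedding `e` lays out disjoint blocks indexed by `κ`, each
with positions indexed by `α`. -/
noncomputable def blockVec {d : ℕ} {κ α : Type*} [Fintype κ] (e : κ × α ↪ Fin d) (a : ℝ)
    (f : κ → α) : EuclideanSpace ℝ (Fin d) :=
  ∑ k, EuclideanSpace.single (e (k, f k)) a

/-- The restriction of `u` to block `k`, which splits the squared loss into block losses. -/
noncomputable def blockRestrict {d : ℕ} {κ α : Type*} (e : κ × α ↪ Fin d) (k : κ)
    (u : EuclideanSpace ℝ (Fin d)) : EuclideanSpace ℝ α :=
  WithLp.toLp 2 fun j => u (e (k, j))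

section Blocks

variable {d : ℕ} {κ α : Type*} (e : κ × α ↪ Fin d)

lemma measurable_blockRestrict (k : κ) : Measurable (blockRestrict e k) := by
  unfold blockRestrict
  fun_prop

lemma sum_norm_blockRestrict_sq_le [Fintype κ] [Fintype α] (u : EuclideanSpace ℝ (Fin d)) :
    ∑ k, ‖blockRestrict e k u‖ ^ 2 ≤ ‖u‖ ^ 2 := by
  simp only [EuclideanSpace.real_norm_sq_eq, blockRestrict]
  rw [← Fintype.sum_prod_type' (f := fun k j => u (e (k, j)) ^ 2),
    ← Finset.sum_map Finset.univ e fun i => u i ^ 2]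
  exact Finset.sum_le_univ_sum_of_nonneg fun i => sq_nonneg _

variable [Fintype κ] (a : ℝ) (f : κ → α)

lemma blockRestrict_blockVec [DecidableEq α] (k : κ) :
    blockRestrict e k (blockVec e a f) = EuclideanSpace.single (f k) a := by
  classical
  ext j
  simp only [blockRestrict, blockVec, WithLp.ofLp_sum, Finset.sum_apply, PiLp.single_apply,
    e.injective.eq_iff, Prod.mk.injEq, ite_and, Finset.sum_ite_eq, Finset.mem_univ, if_true]

lemma l0_blockVec_le : l0 (blockVec e a f) ≤ Fintype.card κ := by
  have hsupp : {i | blockVec e a f i ≠ 0} ⊆ Set.range fun k => e (k, f k) := by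
    intro i hi
    by_contra h
    refine hi ?_
    simp only [blockVec, WithLp.ofLp_sum, Finset.sum_apply, PiLp.single_apply]
    exact Finset.sum_eq_zero fun k _ => if_neg fun hik => h ⟨k, hik.symm⟩
  calc l0 (blockVec e a f) ≤ (Set.range fun k => e (k, f k)).ncard :=
        Set.ncard_le_ncard hsupp
    _ ≤ Fintype.card κ := by
        rw [← Nat.card_eq_fintype_card, ← Nat.card_coe_set_eq]
        exact Finite.card_range_le _

lemma blockVec_update [DecidableEq κ] (k : κ) (j : α) :
    blockVec e a (Function.update f k j) =
      ∑ k' ∈ Finset.univ.erase k, EuclideanSpace.single (e (k', f k')) a +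
        EuclideanSpace.single (e (k, j)) a := by
  rw [blockVec, ← Finset.sum_erase_add _ _ (Finset.mem_univ k), Function.update_self]
  congr 1
  refine Finset.sum_congr rfl fun k' hk' => ?_
  rw [Function.update_of_ne (Finset.ne_of_mem_erase hk')]

lemma sum_sq_norm_blockRestrict_sub_single_le [Fintype α] [DecidableEq α]
    (u : EuclideanSpace ℝ (Fin d)) :
    ∑ k, ENNReal.ofReal (‖blockRestrict e k u - EuclideanSpace.single (f k) a‖ ^ 2) ≤
      sqL2Loss u (blockVec e a f) := by
  rw [sqL2Loss, ← ENNReal.ofReal_sum_of_nonneg fun k _ => sq_nonneg _]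
  refine ENNReal.ofReal_le_ofReal ?_
  simp_rw [← blockRestrict_blockVec e a f]
  exact sum_norm_blockRestrict_sq_le e (u - blockVec e a f)

end Blocks

lemma norm_single_sub_single_sq {α : Type*} [Fintype α] [DecidableEq α] {i j : α} (hij : i ≠ j)
    (a : ℝ) :
    ‖EuclideanSpace.single i a - EuclideanSpace.single j a‖ ^ 2 = 2 * a ^ 2 := by
  rw [norm_sub_sq_real]
  simp [EuclideanSpace.inner_single_left, hij, two_mul]

lemma ofReal_add_ofReal_le_of_norm_sub_single_sq {α : Type*} [Fintype α] [DecidableEq α] (a : ℝ)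
    (w : EuclideanSpace ℝ α) :
    Pairwise fun i j => ENNReal.ofReal (a ^ 2 / 2) + ENNReal.ofReal (a ^ 2 / 2) ≤
      ENNReal.ofReal (‖w - EuclideanSpace.single i a‖ ^ 2) +
        ENNReal.ofReal (‖w - EuclideanSpace.single j a‖ ^ 2) := by
  intro i j hij
  have hpar := parallelogram_law_with_norm ℝ (w - EuclideanSpace.single i a)
    (w - EuclideanSpace.single j a)
  have hdiff := norm_single_sub_single_sq hij.symm a
  rw [sub_sub_sub_cancel_left] at hpar
  beta_reduce
  rw [← ENNReal.ofReal_add (by positivity) (by positivity),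
    ← ENNReal.ofReal_add (by positivity) (by positivity)]
  refine ENNReal.ofReal_le_ofReal ?_
  nlinarith [sq_nonneg ‖w - EuclideanSpace.single i a + (w - EuclideanSpace.single j a)‖]

section LowerBound

variable {n d : ℕ} {X : Matrix (Fin n) (Fin d) ℝ} {σ : ℝ≥0} {κ α : Type*} [Fintype κ]
  [Fintype α] {e : κ × α ↪ Fin d} {a : ℝ}

lemma expect_regressionLaw_real_le (hσ : σ ≠ 0) (hα : 2 ≤ Fintype.card α) {b : α → Fin d}
    (θ : EuclideanSpace ℝ (Fin d))
    (ha : ∀ j, a ^ 2 * (∑ i, X i (b j) ^ 2) / σ ^ 2 ≤ Real.log (Fintype.card α) / 2)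
    {A : α → Set (Fin n → ℝ)} (hA : ∀ j, MeasurableSet (A j))
    (hdisj : Pairwise (Function.onFun Disjoint A)) :
    𝔼 j, (regressionLaw X σ (θ + EuclideanSpace.single (b j) a)).real (A j) ≤ 7 / 8 := by
  have hm : (2 : ℝ) ≤ Fintype.card α := by exact_mod_cast hα
  have htest := expect_measureReal_sq_le_of_disjoint (Q := regressionLaw X σ θ) hA hdisj
    (Real.sqrt_nonneg (Fintype.card α)) fun j =>
      (regressionLaw_add_single_real_sq_le X hσ θ (b j) a (A j)).trans <| by
        gcongr
        rw [← Real.exp_log (by positivity : (0 : ℝ) < Fintype.card α), ← Real.exp_half]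
        exact Real.exp_le_exp.2 (ha j)
  have hsqrt : √(Fintype.card α : ℝ) / Fintype.card α ≤ (7 / 8) ^ 2 := by
    rw [div_le_iff₀ (by positivity), Real.sqrt_le_left (by positivity)]
    nlinarith
  exact le_of_sq_le_sq (htest.trans hsqrt) (by norm_num)

lemma ofReal_le_sparseRegressionMinimaxRisk_of_sq_mul_le {s : ℕ} (hσ : σ ≠ 0)
    (hκ : Fintype.card κ ≤ s) (hα : 2 ≤ Fintype.card α)
    (ha : ∀ q, a ^ 2 * (∑ i, X i (e q) ^ 2) / σ ^ 2 ≤ Real.log (Fintype.card α) / 2) :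
    ENNReal.ofReal (a ^ 2 * Fintype.card κ / 16) ≤ sparseRegressionMinimaxRisk X σ s := by
  classical
  have : Nonempty α := Fintype.card_pos_iff.1 (by omega)
  let spikes (f : κ → α) : SparseVec d s := ⟨blockVec e a f, (l0_blockVec_le e a f).trans hκ⟩
  refine le_trans ?_ (minimaxRiskOf_comp_le spikes _ _ _)
  have h := mul_le_minimaxRiskOf_of_blocks
    (P := fun f => regressionLaw X σ (blockVec e a f)) (θ := fun f => blockVec e a f)
    (ℓ := sqL2Loss) (δ := ENNReal.ofReal (a ^ 2 / 2)) (p := 7 / 8)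
    (ℓb := fun k j u => ENNReal.ofReal (‖blockRestrict e k u - EuclideanSpace.single j a‖ ^ 2))
    (fun k j => by have := measurable_blockRestrict e k; fun_prop)
    (fun f u => sum_sq_norm_blockRestrict_sub_single_le e a f u)
    (fun k u => ofReal_add_ofReal_le_of_norm_sub_single_sq a (blockRestrict e k u))
    (fun k f A hA hdisj => by
      simp_rw [blockVec_update]
      exact expect_regressionLaw_real_le hσ hα _ (fun j => ha (k, j)) hA hdisj)
  rw [← ENNReal.ofReal_mul (by positivity)] at h
  refine le_of_eq_of_le ?_ h
  congr 1
  ring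

lemma ofReal_le_sparseRegressionMinimaxRisk_of_col_sq_sum_le {s : ℕ} {B : ℝ} (hσ : σ ≠ 0)
    (hκ : Fintype.card κ ≤ s) (hα : 2 ≤ Fintype.card α) (hB : 0 < B)
    (hcol : ∀ q, ∑ i, X i (e q) ^ 2 ≤ B) :
    ENNReal.ofReal (σ ^ 2 * Real.log (Fintype.card α) * Fintype.card κ / (32 * B)) ≤
      sparseRegressionMinimaxRisk X σ s := by
  have hσ' : (σ : ℝ) ≠ 0 := NNReal.coe_ne_zero.2 hσ
  have ha : √(σ ^ 2 * Real.log (Fintype.card α) / (2 * B)) ^ 2 =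
      σ ^ 2 * Real.log (Fintype.card α) / (2 * B) := Real.sq_sqrt (by positivity)
  have h := ofReal_le_sparseRegressionMinimaxRisk_of_sq_mul_le (X := X) (e := e) hσ hκ hα
    (a := √(σ ^ 2 * Real.log (Fintype.card α) / (2 * B))) fun q => by
      rw [ha]
      calc σ ^ 2 * Real.log (Fintype.card α) / (2 * B) * (∑ i, X i (e q) ^ 2) / σ ^ 2
          ≤ σ ^ 2 * Real.log (Fintype.card α) / (2 * B) * B / σ ^ 2 := by gcongr; exact hcol q
        _ = Real.log (Fintype.card α) / 2 := by field_simp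
  rw [ha] at h
  convert h using 2
  field_simp
  ring

end LowerBound

lemma frobenius_norm_sq_eq_sum {m n E : Type*} [Fintype m] [Fintype n] [SeminormedAddCommGroup E]
    (X : Matrix m n E) : ‖X‖ ^ 2 = ∑ j, ∑ i, ‖X i j‖ ^ 2 := by
  rw [Matrix.frobenius_norm_def, ← Real.sqrt_eq_rpow, Real.sq_sqrt (by positivity),
    Finset.sum_comm]
  simp only [Real.rpow_two]

lemma card_lt_two_mul_card_filter_le_two_mul_expect {ι K : Type*} [Fintype ι] [Nonempty ι]
    [Field K] [LinearOrder K] [IsStrictOrderedRing K] {f : ι → K} (hf : ∀ i, 0 ≤ f i) :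
    Fintype.card ι < 2 * (Finset.univ.filter fun i => f i ≤ 2 * 𝔼 j, f j).card := by
  have hsplit := Finset.card_filter_add_card_filter_not (s := Finset.univ)
    fun i => f i ≤ 2 * 𝔼 j, f j
  set heavy := Finset.univ.filter fun i => ¬ f i ≤ 2 * 𝔼 j, f j
  rw [Finset.card_univ] at hsplit
  by_contra! hcard
  have hle : Fintype.card ι ≤ 2 * heavy.card := by omega
  have hne : heavy.Nonempty := Finset.card_pos.1 (by have := Fintype.card_pos (α := ι); omega)
  have hmean : 0 ≤ 𝔼 j, f j := Finset.expect_nonneg fun i _ => hf i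
  refine lt_irrefl (∑ i, f i) ?_
  calc ∑ i, f i = Fintype.card ι * 𝔼 j, f j := (Fintype.card_mul_expect f).symm
    _ ≤ ((2 * heavy.card : ℕ) : K) * 𝔼 j, f j := by gcongr
    _ = ∑ _i ∈ heavy, 2 * 𝔼 j, f j := by
        rw [Finset.sum_const, nsmul_eq_mul]
        push_cast
        ring
    _ < ∑ i ∈ heavy, f i :=
        Finset.sum_lt_sum_of_nonempty hne fun i hi => not_le.1 (Finset.mem_filter.1 hi).2
    _ ≤ ∑ i, f i := Finset.sum_le_univ_sum_of_nonneg hf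

lemma exists_block_dimensions {s d g : ℕ} (hs : 1 ≤ s) (hsd : s < d) (hg : d < 2 * g) :
    ∃ r m : ℕ, r ≤ s ∧ s ≤ 4 * r ∧ 2 ≤ m ∧ r * m ≤ g ∧ d ≤ s * m ^ 3 := by
  have hr : 0 < (s + 3) / 4 := by omega
  have hm : 2 ≤ g / ((s + 3) / 4) := (Nat.le_div_iff_mul_le hr).2 (by omega)
  have hgm : g < (s + 3) / 4 * (g / ((s + 3) / 4) + 1) := Nat.lt_mul_div_succ g hr
  refine ⟨(s + 3) / 4, g / ((s + 3) / 4), by omega, by omega, hm, Nat.mul_div_le _ _, ?_⟩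
  have hrs : (s + 3) / 4 ≤ s := by omega
  generalize (s + 3) / 4 = r at *
  generalize g / r = m at *
  have hcube : 2 * (m + 1) ≤ m ^ 3 := by nlinarith [Nat.pow_le_pow_left hm 2]
  calc d ≤ 2 * g := hg.le
    _ ≤ 2 * (r * (m + 1)) := by gcongr
    _ ≤ 2 * (s * (m + 1)) := by gcongr
    _ = s * (2 * (m + 1)) := by ring
    _ ≤ s * m ^ 3 := by gcongr

lemma exists_block_embedding_le_two_mul_expect {K : Type*} [Field K] [LinearOrder K]
    [IsStrictOrderedRing K] {s d : ℕ} (hs : 1 ≤ s) (hsd : s < d) {f : Fin d → K}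
    (hf : ∀ j, 0 ≤ f j) :
    ∃ (r m : ℕ) (e : Fin r × Fin m ↪ Fin d),
      r ≤ s ∧ s ≤ 4 * r ∧ 2 ≤ m ∧ d ≤ s * m ^ 3 ∧ ∀ q, f (e q) ≤ 2 * 𝔼 j, f j := by
  have : NeZero d := ⟨by omega⟩
  have hlight := card_lt_two_mul_card_filter_le_two_mul_expect hf
  rw [Fintype.card_fin] at hlight
  obtain ⟨r, m, hrs, hsr, hm, hrm, hdm⟩ := exists_block_dimensions hs hsd hlight
  obtain ⟨e⟩ : Nonempty (Fin r × Fin m ↪ {j // f j ≤ 2 * 𝔼 i, f i}) :=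
    Function.Embedding.nonempty_of_card_le (by simpa [Fintype.card_subtype] using hrm)
  exact ⟨r, m, e.trans (Function.Embedding.subtype _), hrs, hsr, hm, hdm, fun q => (e q).2⟩

lemma mul_log_div_le_of_le_mul_pow {s d r m : ℕ} (hs : 0 < s) (hd : 0 < d) (hr : s ≤ 4 * r)
    (hm : d ≤ s * m ^ 3) :
    s * Real.log (d / s) ≤ 12 * (r * Real.log m) := by
  have hdiv : (d / s : ℝ) ≤ m ^ 3 := by
    rw [div_le_iff₀' (by positivity)]
    exact_mod_cast hm
  calc s * Real.log (d / s) ≤ s * Real.log ((m : ℝ) ^ 3) := by gcongr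
    _ = s * (3 * Real.log m) := by rw [Real.log_pow]; norm_num
    _ ≤ (4 * r : ℕ) * (3 * Real.log m) := by gcongr
    _ = 12 * (r * Real.log m) := by push_cast; ring

theorem corollary4 :
    ∃ c : ℝ, 0 < c ∧
      ∀ (n d s : ℕ) (σ : ℝ≥0) (X : Matrix (Fin n) (Fin d) ℝ),
        0 < σ → 1 ≤ s → s ≤ d → X ≠ 0 →
          ENNReal.ofReal
              (c * ((σ : ℝ) ^ 2 * (s : ℝ) * (d : ℝ) * Real.log ((d : ℝ) / (s : ℝ))) / ‖X‖ ^ 2) ≤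
            sparseRegressionMinimaxRisk X σ s := by
  refine ⟨1 / 768, by norm_num, fun n d s σ X hσ hs hsd hX => ?_⟩
  rcases hsd.eq_or_lt with rfl | hlt
  · simp [Nat.cast_ne_zero.2 (Nat.one_le_iff_ne_zero.1 hs)]
  have hd : 0 < d := by omega
  have hmean : 𝔼 j, ∑ i, X i j ^ 2 = ‖X‖ ^ 2 / d := by
    simp [Fintype.expect_eq_sum_div_card, frobenius_norm_sq_eq_sum]
  obtain ⟨r, m, e, hrs, hsr, hm, hdm, hlight⟩ := exists_block_embedding_le_two_mul_expect hs hlt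
    (f := fun j => ∑ i, X i j ^ 2) fun j => Finset.sum_nonneg fun i _ => sq_nonneg _
  have hrisk := ofReal_le_sparseRegressionMinimaxRisk_of_col_sq_sum_le (X := X) (e := e)
    (B := 2 * (‖X‖ ^ 2 / d)) hσ.ne' (by simpa using hrs) (by simpa using hm) (by positivity)
    fun q => hmean ▸ hlight q
  rw [Fintype.card_fin, Fintype.card_fin] at hrisk
  refine (ENNReal.ofReal_le_ofReal ?_).trans hrisk
  have hlog := mul_log_div_le_of_le_mul_pow hs hd hsr hdm
  calc 1 / 768 * (σ ^ 2 * s * d * Real.log (d / s)) / ‖X‖ ^ 2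
      = σ ^ 2 * d / (768 * ‖X‖ ^ 2) * (s * Real.log (d / s)) := by ring
    _ ≤ σ ^ 2 * d / (768 * ‖X‖ ^ 2) * (12 * (r * Real.log m)) := by gcongr
    _ = σ ^ 2 * Real.log m * r / (32 * (2 * (‖X‖ ^ 2 / d))) := by field_simp; ring
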